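/- Let $\mathcal U,\mathcal V,\mathcal Z$ be finite alphabets and let $(U,V,Z)\sim p(u,v,z)$ on $\mathcal U\times\mathcal V\times\mathcal Z$. Entropies and mutual informations are in bits. For a pmf $q$ on a finite set, $\mathcal T_\epsilon^{(n)}$ is the set of $\epsilon$-typical sequences $x^n$, i.e. those with $\bigl|\tfrac1n|\{i: x_i=a\}|-q(a)\bigr|\le \epsilon\, q(a)$ for every letter $a$; below it is taken for $q=p(u,v,z)$. Let $\delta(\epsilon)\ge 0$ be any function with $\delta(\epsilon)\to 0$ as $\epsilon\to 0^+$. Then there is a function $\delta'(\epsilon)>0$ (depending only on $p$ and $\delta(\cdot)$), with $\delta'(\epsilon)\to 0$ as $\epsilon\to 0^+$, such that the following holds for all $\epsilon>0$ and all $S\ge 0$ with $S\ge I(V;Z|U)+\delta(\epsilon)$. For each $n$, let $[1:2^{nS}]$ denote an index set $\{1,\dots,M_n\}$ whose size is $2^{nS}$ up to rounding ($\lfloor 2^{nS}\rfloor\le M_n\le 2^{\lceil nS\rceil}$), and, on some probability space, let $U^n$ be a random sequence distributed according to $\prod_{i=1}^n p_U(u_i)$; let $V^n(l)$, $l\in[1:2^{nS}]$,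 be random sequences that are conditionally independent given $U^n$, each conditionally distributed according to $\prod_{i=1}^n p_{V|U}(v_i|u_i)$; let $\mathcal C=\{U^n,V^n(l): l\in[1:2^{nS}]\}$; let $L\in[1:2^{nS}]$ be an arbitrary random index and $Z^n\in\mathcal Z^n$ an arbitrary random sequence (both may depend arbitrarily on each other and on $\mathcal C$). If $$\mathsf P\{(U^n,V^n(L),Z^n)\in\mathcal T_\epsilon^{(n)}\}\to 1\quad\text{as } n\to\infty,$$ then for all $n$ sufficiently large $$H(L\,|\,Z^n,U^n,\mathcal C)\le n\bigl(S-I(V;Z|U)\bigr)+n\,\delta'(\epsilon).$$ -/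

import Mathlib

open MeasureTheory ProbabilityTheory Filter Topology

noncomputable section

/-- Shannon entropy `H(X)`, in bits, of a random variable `X` with values in a finite set. -/
def entropyBits {Ω α : Type*} [MeasurableSpace Ω] [Fintype α]
    (P : Measure Ω) (X : Ω → α) : ℝ :=
  ∑ x, -(P.real (X ⁻¹' {x}) * Real.logb 2 (P.real (X ⁻¹' {x})))

/-- Conditional entropy `H(X | Y) = ∑ y, P(Y = y) H(X | Y = y)`, in bits, of random variables
with values in finite sets; `P[|E]` is the conditional probability given the event `E`. -/
def condEntropyBits {Ω α β : Type*} [MeasurableSpace Ω] [Fintype α] [Fintype β]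
    (P : Measure Ω) (X : Ω → α) (Y : Ω → β) : ℝ :=
  ∑ y, P.real (Y ⁻¹' {y}) * entropyBits P[|Y ⁻¹' {y}] X

/-- Conditional mutual information `I(X; Y | W) = H(X | W) - H(X | Y, W)`, in bits. -/
def condMutualInfoBits {Ω α β γ : Type*} [MeasurableSpace Ω]
    [Fintype α] [Fintype β] [Fintype γ]
    (P : Measure Ω) (X : Ω → α) (Y : Ω → β) (W : Ω → γ) : ℝ :=
  condEntropyBits P X W - condEntropyBits P X (fun ω => (Y ω, W ω))

open Classical in
/-- The empirical frequency `π(a | xⁿ) = #{i | x i = a} / n` of a letter in a sequence. -/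
def empiricalFreq {α : Type*} {n : ℕ} (x : Fin n → α) (a : α) : ℝ :=
  ((Finset.univ.filter fun i => x i = a).card : ℝ) / n

/-- The (robustly) `ε`-typical sequences of length `n` for the pmf `q`:
`|π(a | xⁿ) - q(a)| ≤ ε q(a)` for every letter `a`. -/
def typicalSet {α : Type*} (q : PMF α) (ε : ℝ) (n : ℕ) : Set (Fin n → α) :=
  {x | ∀ a, |empiricalFreq x a - (q a).toReal| ≤ ε * (q a).toReal}

section Triple

variable {A B C : Type*}

/-- The marginal pmf `p_U(u)` of a joint pmf `p(u, v, z)`. -/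
def pmfU (p : PMF (A × B × C)) (u : A) : ℝ :=
  (p.map (fun t => t.1) u).toReal

/-- The conditional pmf `p_{V|U}(v | u) = p_{U,V}(u, v) / p_U(u)` of a joint pmf `p(u, v, z)`
(only relevant where `p_U(u) > 0`). -/
def pmfVgivenU (p : PMF (A × B × C)) (v : B) (u : A) : ℝ :=
  (p.map (fun t => (t.1, t.2.1)) (u, v)).toReal / pmfU p u

/-- `I(V; Z | U)`, in bits, for `(U, V, Z) ∼ p(u, v, z)`. -/
def infoVZgivenU [Fintype A] [Fintype B] [Fintype C]
    [MeasurableSpace A] [MeasurableSpace B] [MeasurableSpace C]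
    (p : PMF (A × B × C)) : ℝ :=
  condMutualInfoBits p.toMeasure (fun t => t.2.1) (fun t => t.2.2) (fun t => t.1)

/-- `Uⁿ ∼ ∏ᵢ p_U(uᵢ)` and, given `Uⁿ`, the sequences `Vⁿ(l)` are (mutually) conditionally
independent, each distributed according to `∏ᵢ p_{V|U}(vᵢ | uᵢ)`. -/
def IsRandomCodebook [MeasurableSpace B] {Ω ι : Type*} [MeasurableSpace Ω]
    (p : PMF (A × B × C)) {n : ℕ} (P : Measure Ω)
    (U : Ω → Fin n → A) (V : ι → Ω → Fin n → B) : Prop :=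
  (∀ u, P.real (U ⁻¹' {u}) = ∏ i, pmfU p (u i)) ∧
  ∀ u, P (U ⁻¹' {u}) ≠ 0 →
    iIndepFun V P[|U ⁻¹' {u}] ∧
    ∀ l v, (P[|U ⁻¹' {u}]).real (V l ⁻¹' {v}) = ∏ i, pmfVgivenU p (v i) (u i)

end Triple

/-- The codebook `𝒞 = {Uⁿ, Vⁿ(l)}`, as a random variable. -/
def codebook {Ω ι A' B' : Type*} (U : Ω → A') (V : ι → Ω → B') (ω : Ω) : A' × (ι → B') :=
  (U ω, fun l => V l ω)

end

noncomputable section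

/-! Given `(Zⁿ, Uⁿ, 𝒞)`, list the indices `l` with `(Uⁿ, Vⁿ(l), Zⁿ)` typical. By hypothesis `L` is
on the list with probability tending to 1, so `H(L | Zⁿ, Uⁿ, 𝒞)` is at most the log of the list size
plus a vanishing fraction of `log M` (`condEntropyBits_index_le`).

The list must be short although `Zⁿ` may depend on the codebook. For fixed `u, z` its length counts
hits among independent codewords, each hitting with probability at most `2^{-n(I - cε)}`, where `c =
E|ι|` and `ι` is the information density (`sum_prod_pmfVgivenU_typical_le`). The mean is thus at
most `2 · 2^{-nε} K` for `K = 2^{n(S - I + cε + ε)}`, and by Chernoff the length reaches `K` with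
doubly exponentially small probability. This survives a union bound over all `|𝒵|^n` sequences `z`
(`IsRandomCodebook.card_typicalIndices_ge_le`). -/

lemma cond_real_apply {Ω : Type*} [MeasurableSpace Ω] {s : Set Ω} (hs : MeasurableSet s)
    (μ : Measure Ω) (t : Set Ω) : (μ[|s]).real t = (μ.real s)⁻¹ * μ.real (s ∩ t) := by
  simp [Measure.real, cond_apply hs]

/-! ### Marginals and conditional entropy of a finite pmf -/

section FinitePMF

variable {T : Type*} [Fintype T]

open Classical in
lemma toReal_map_apply {β : Type*} (p : PMF T) (f : T → β) (b : β) :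
    (p.map f b).toReal = ∑ t with f t = b, (p t).toReal := by
  rw [PMF.map_apply, tsum_fintype, ENNReal.toReal_sum, Finset.sum_filter]
  · refine Finset.sum_congr rfl fun t _ => ?_
    by_cases h : f t = b
    · simp [h]
    · simp [h, Ne.symm h]
  · intro t _
    split_ifs
    · exact p.apply_ne_top t
    · simp

lemma toReal_le_toReal_map_apply {β : Type*} (p : PMF T) (f : T → β) (t : T) :
    (p t).toReal ≤ (p.map f (f t)).toReal := by
  classical
  rw [toReal_map_apply]
  exact Finset.single_le_sum (f := fun t => (p t).toReal) (fun _ _ => ENNReal.toReal_nonneg)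
    (by simp)

variable [MeasurableSpace T] [MeasurableSingletonClass T]

open Classical in
lemma toMeasure_real_preimage {β : Type*} (p : PMF T) (f : T → β) (b : β) :
    p.toMeasure.real (f ⁻¹' {b}) = (p.map f b).toReal := by
  rw [toReal_map_apply, Measure.real]
  have : f ⁻¹' {b} = ((Finset.univ.filter fun t => f t = b : Finset T) : Set T) := by
    ext; simp
  rw [this, PMF.toMeasure_apply_finset, ENNReal.toReal_sum fun t _ => p.apply_ne_top t]

/-- As expectations over one common sample space, two conditional entropies subtract term by term;
this turns `I(V;Z|U)` into the mean information density. -/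
lemma condEntropyBits_toMeasure {α β : Type*} [Fintype α] [Fintype β] (p : PMF T)
    (X : T → α) (Y : T → β) :
    condEntropyBits p.toMeasure X Y = ∑ t, (p t).toReal *
      -Real.logb 2 ((p.map (fun t => (Y t, X t)) (Y t, X t)).toReal / (p.map Y (Y t)).toReal) := by
  classical
  set F : β × α → ℝ := fun b =>
    -Real.logb 2 ((p.map (fun t => (Y t, X t)) b).toReal / (p.map Y b.1).toReal) with hF
  have hjoint : ∀ y x, p.toMeasure.real (Y ⁻¹' {y} ∩ X ⁻¹' {x})
      = (p.map (fun t => (Y t, X t)) (y, x)).toReal := by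
    intro y x
    rw [← toMeasure_real_preimage]
    congr 1
    ext t
    simp
  have hcond : ∀ y x, (p.toMeasure[|Y ⁻¹' {y}]).real (X ⁻¹' {x})
      = (p.map (fun t => (Y t, X t)) (y, x)).toReal / (p.map Y y).toReal := by
    intro y x
    rw [cond_real_apply (Set.toFinite _).measurableSet, hjoint, toMeasure_real_preimage,
      div_eq_inv_mul]
  have key : condEntropyBits p.toMeasure X Y
      = ∑ b : β × α, (p.map (fun t => (Y t, X t)) b).toReal * F b := by
    rw [Fintype.sum_prod_type]
    refine Finset.sum_congr rfl fun y _ => ?_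
    rw [entropyBits, Finset.mul_sum]
    refine Finset.sum_congr rfl fun x _ => ?_
    rw [hcond, toMeasure_real_preimage, hF]
    by_cases h : (p.map Y y).toReal = 0
    · have h0 : (p.map (fun t => (Y t, X t)) (y, x)).toReal = 0 := by
        rw [← hjoint]
        refine le_antisymm ?_ measureReal_nonneg
        rw [← h, ← toMeasure_real_preimage]
        exact measureReal_mono Set.inter_subset_left
      rw [h, h0]; simp
    · field_simp
  rw [key, ← Finset.sum_fiberwise Finset.univ (fun t => (Y t, X t))]
  refine Finset.sum_congr rfl fun b _ => ?_
  rw [toReal_map_apply, Finset.sum_mul]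
  refine Finset.sum_congr (by ext; simp) fun t ht => ?_
  rw [← (Finset.mem_filter.1 ht).2]

end FinitePMF

/-! ### Robust typicality -/

section Typical

variable {α : Type*} {q : PMF α} {ε : ℝ} {n : ℕ} {x : Fin n → α}

lemma sum_comp_eq_empiricalFreq [Fintype α] (g : α → ℝ) (x : Fin n → α) :
    ∑ i, g (x i) = n * ∑ a, empiricalFreq x a * g a := by
  classical
  rcases Nat.eq_zero_or_pos n with rfl | hn
  · simp
  have hn' : (n : ℝ) ≠ 0 := by positivity
  rw [← Finset.sum_fiberwise Finset.univ x, Finset.mul_sum]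
  refine Finset.sum_congr rfl fun a _ => ?_
  rw [Finset.sum_congr rfl (g := fun _ => g a)
    (fun i hi => by rw [(Finset.mem_filter.1 hi).2]), Finset.sum_const, nsmul_eq_mul,
    empiricalFreq, ← mul_assoc, mul_div_cancel₀ _ hn']

lemma ne_zero_of_mem_typicalSet (hx : x ∈ typicalSet q ε n) (i : Fin n) : q (x i) ≠ 0 := by
  classical
  intro h
  have h1 := hx (x i)
  rw [h] at h1
  simp only [ENNReal.toReal_zero, sub_zero, mul_zero, abs_nonpos_iff, empiricalFreq,
    div_eq_zero_iff, Nat.cast_eq_zero] at h1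
  rcases h1 with h1 | h1
  · have := Finset.filter_eq_empty_iff.1 (Finset.card_eq_zero.1 h1) (Finset.mem_univ i)
    exact this rfl
  · exact absurd i.2 (by omega)

/-- The typical average lemma, for a function of arbitrary sign. -/
lemma le_sum_comp_of_mem_typicalSet [Fintype α] (hx : x ∈ typicalSet q ε n) (g : α → ℝ) :
    n * (∑ a, (q a).toReal * g a - ε * ∑ a, (q a).toReal * |g a|) ≤ ∑ i, g (x i) := by
  rw [sum_comp_eq_empiricalFreq]
  refine mul_le_mul_of_nonneg_left ?_ (Nat.cast_nonneg n)
  rw [Finset.mul_sum, ← Finset.sum_sub_distrib]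
  refine Finset.sum_le_sum fun a _ => ?_
  have h := mul_le_mul_of_nonneg_right (hx a) (abs_nonneg (g a))
  rw [← abs_mul] at h
  have := (abs_le.1 h).1
  linarith

end Typical

/-! ### Information density and the joint typicality bound -/

section InfoDensity

variable {A B C : Type*}

/-- The conditional pmf `p_{V|U,Z}(v | u, z)` of a joint pmf `p(u, v, z)`
(only relevant where `p_{U,Z}(u, z) > 0`). -/
def pmfVgivenUZ (p : PMF (A × B × C)) (v : B) (u : A) (z : C) : ℝ :=
  (p (u, v, z)).toReal / (p.map (fun t => (t.2.2, t.1)) (z, u)).toReal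

/-- The conditional information density `log (p_{V|U,Z}(v | u, z) / p_{V|U}(v | u))`, in bits. -/
def infoDensity (p : PMF (A × B × C)) (t : A × B × C) : ℝ :=
  Real.logb 2 (pmfVgivenUZ p t.2.1 t.1 t.2.2) - Real.logb 2 (pmfVgivenU p t.2.1 t.1)

/-- The mean absolute value of the conditional information density. -/
def meanAbsInfoDensity [Fintype A] [Fintype B] [Fintype C] (p : PMF (A × B × C)) : ℝ :=
  ∑ t, (p t).toReal * |infoDensity p t|

lemma pmfVgivenUZ_nonneg (p : PMF (A × B × C)) (v : B) (u : A) (z : C) :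
    0 ≤ pmfVgivenUZ p v u z :=
  div_nonneg ENNReal.toReal_nonneg ENNReal.toReal_nonneg

variable [Fintype A] [Fintype B] [Fintype C]

lemma meanAbsInfoDensity_nonneg (p : PMF (A × B × C)) : 0 ≤ meanAbsInfoDensity p :=
  Finset.sum_nonneg fun _ _ => mul_nonneg ENNReal.toReal_nonneg (abs_nonneg _)

lemma sum_pmfVgivenUZ_le_one (p : PMF (A × B × C)) (u : A) (z : C) :
    ∑ v, pmfVgivenUZ p v u z ≤ 1 := by
  classical
  simp only [pmfVgivenUZ]
  rw [← Finset.sum_div]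
  refine div_le_one_of_le₀ ?_ ENNReal.toReal_nonneg
  rw [toReal_map_apply, ← Finset.sum_image (f := fun t => (p t).toReal) (g := fun v => (u, v, z))
    (by intro a _ b _ h; simpa using h)]
  refine Finset.sum_le_sum_of_subset_of_nonneg ?_ fun _ _ _ => ENNReal.toReal_nonneg
  intro t ht
  obtain ⟨v, -, rfl⟩ := Finset.mem_image.1 ht
  simp

lemma pmfVgivenU_pos {p : PMF (A × B × C)} {u : A} {v : B} {z : C} (h : p (u, v, z) ≠ 0) :
    0 < pmfVgivenU p v u := by
  have h0 : 0 < (p (u, v, z)).toReal := ENNReal.toReal_pos h (p.apply_ne_top _)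
  exact div_pos (h0.trans_le (toReal_le_toReal_map_apply p (fun t => (t.1, t.2.1)) (u, v, z)))
    (h0.trans_le (toReal_le_toReal_map_apply p (fun t => t.1) (u, v, z)))

lemma pmfVgivenUZ_pos {p : PMF (A × B × C)} {u : A} {v : B} {z : C} (h : p (u, v, z) ≠ 0) :
    0 < pmfVgivenUZ p v u z := by
  have h0 : 0 < (p (u, v, z)).toReal := ENNReal.toReal_pos h (p.apply_ne_top _)
  exact div_pos h0
    (h0.trans_le (toReal_le_toReal_map_apply p (fun t => (t.2.2, t.1)) (u, v, z)))

lemma infoVZgivenU_eq_sum [MeasurableSpace A] [MeasurableSingletonClass A]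
    [MeasurableSpace B] [MeasurableSingletonClass B]
    [MeasurableSpace C] [MeasurableSingletonClass C] (p : PMF (A × B × C)) :
    infoVZgivenU p = ∑ t, (p t).toReal * infoDensity p t := by
  classical
  have hz : ∀ t : A × B × C, (p.map (fun t => ((t.2.2, t.1), t.2.1)) ((t.2.2, t.1), t.2.1)).toReal
      = (p t).toReal := by
    intro t
    rw [toReal_map_apply, Finset.sum_eq_single_of_mem t (by simp)]
    rintro ⟨a, b, c⟩ hs hne
    obtain ⟨u, v, z⟩ := t
    simp at hs hne
    tauto
  have hv : ∀ t : A × B × C, (p.map (fun t => (t.1, t.2.1)) (t.1, t.2.1)).toReal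
      / (p.map (fun t => t.1) t.1).toReal = pmfVgivenU p t.2.1 t.1 := fun t => rfl
  rw [infoVZgivenU, condMutualInfoBits, condEntropyBits_toMeasure, condEntropyBits_toMeasure,
    ← Finset.sum_sub_distrib]
  refine Finset.sum_congr rfl fun t _ => ?_
  rw [hz, hv, infoDensity, pmfVgivenUZ]
  ring

/-- Change of measure: on the support `p_{V|U} = 2^{-ι} p_{V|U,Z}`, and typicality keeps every
coordinate in the support and bounds the sum of the `ι` below. -/
lemma prod_pmfVgivenU_le [MeasurableSpace A] [MeasurableSingletonClass A]
    [MeasurableSpace B] [MeasurableSingletonClass B]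
    [MeasurableSpace C] [MeasurableSingletonClass C] (p : PMF (A × B × C)) {ε : ℝ} {n : ℕ}
    {u : Fin n → A} {v : Fin n → B} {z : Fin n → C}
    (h : (fun i => (u i, v i, z i)) ∈ typicalSet p ε n) :
    ∏ i, pmfVgivenU p (v i) (u i) ≤
      (2 : ℝ) ^ (-(n * (infoVZgivenU p - ε * meanAbsInfoDensity p))) *
        ∏ i, pmfVgivenUZ p (v i) (u i) (z i) := by
  have hfac : ∀ i, pmfVgivenU p (v i) (u i)
      = (2 : ℝ) ^ (-infoDensity p (u i, v i, z i)) * pmfVgivenUZ p (v i) (u i) (z i) := by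
    intro i
    have hi := ne_zero_of_mem_typicalSet h i
    have h1 := pmfVgivenU_pos hi
    have h2 := pmfVgivenUZ_pos hi
    rw [infoDensity, neg_sub, Real.rpow_sub two_pos, Real.rpow_logb two_pos (by norm_num) h1,
      Real.rpow_logb two_pos (by norm_num) h2, div_mul_cancel₀ _ h2.ne']
  rw [Finset.prod_congr rfl fun i _ => hfac i, Finset.prod_mul_distrib,
    ← Real.rpow_sum_of_pos two_pos]
  refine mul_le_mul_of_nonneg_right ?_ (Finset.prod_nonneg fun i _ => pmfVgivenUZ_nonneg _ _ _ _)
  refine Real.rpow_le_rpow_of_exponent_le one_le_two ?_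
  rw [Finset.sum_neg_distrib, infoVZgivenU_eq_sum]
  exact neg_le_neg (le_sum_comp_of_mem_typicalSet h (infoDensity p))

open Classical in
/-- Joint typicality of an independently drawn `vⁿ` with `(uⁿ, zⁿ)` has probability at most
`2^{-n (I(V;Z|U) - ε E|ι|)}`. -/
lemma sum_prod_pmfVgivenU_typical_le [MeasurableSpace A] [MeasurableSingletonClass A]
    [MeasurableSpace B] [MeasurableSingletonClass B]
    [MeasurableSpace C] [MeasurableSingletonClass C] (p : PMF (A × B × C)) (ε : ℝ) {n : ℕ}
    (u : Fin n → A) (z : Fin n → C) :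
    ∑ v : Fin n → B with (fun i => (u i, v i, z i)) ∈ typicalSet p ε n,
        ∏ i, pmfVgivenU p (v i) (u i) ≤
      (2 : ℝ) ^ (-(n * (infoVZgivenU p - ε * meanAbsInfoDensity p))) := by
  calc _ ≤ ∑ v : Fin n → B with (fun i => (u i, v i, z i)) ∈ typicalSet p ε n,
        (2 : ℝ) ^ (-(n * (infoVZgivenU p - ε * meanAbsInfoDensity p))) *
          ∏ i, pmfVgivenUZ p (v i) (u i) (z i) :=
        Finset.sum_le_sum fun v hv => prod_pmfVgivenU_le p (Finset.mem_filter.1 hv).2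
    _ ≤ ∑ v : Fin n → B, (2 : ℝ) ^ (-(n * (infoVZgivenU p - ε * meanAbsInfoDensity p))) *
          ∏ i, pmfVgivenUZ p (v i) (u i) (z i) :=
        Finset.sum_le_sum_of_subset_of_nonneg (Finset.filter_subset _ _) fun v _ _ =>
          mul_nonneg (by positivity) (Finset.prod_nonneg fun i _ => pmfVgivenUZ_nonneg _ _ _ _)
    _ = (2 : ℝ) ^ (-(n * (infoVZgivenU p - ε * meanAbsInfoDensity p))) *
          ∏ i, ∑ b, pmfVgivenUZ p b (u i) (z i) := by
        rw [← Finset.mul_sum, Finset.prod_univ_sum, Fintype.piFinset_univ]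
    _ ≤ _ := mul_le_of_le_one_right (by positivity) (Finset.prod_le_one
        (fun i _ => Finset.sum_nonneg fun b _ => pmfVgivenUZ_nonneg _ _ _ _)
        fun i _ => sum_pmfVgivenUZ_le_one p (u i) (z i))

end InfoDensity

/-! ### Entropy of a variable mostly confined to a small set -/

section EntropyBound

variable {Ω α β : Type*} [MeasurableSpace Ω] [Fintype α] [Fintype β]

/-- Gibbs' inequality against a sub-probability weight. -/
lemma sum_mul_neg_logb_le {p w : α → ℝ} (hp : ∀ x, 0 ≤ p x) (hsum : ∑ x, p x = 1)
    (hw : ∀ x, 0 < w x) (hw1 : ∑ x, w x ≤ 1) :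
    ∑ x, -(p x * Real.logb 2 (p x)) ≤ ∑ x, p x * -Real.logb 2 (w x) := by
  have hl : 0 < Real.log 2 := Real.log_pos one_lt_two
  have key : ∀ x, p x * Real.log (w x) - p x * Real.log (p x) ≤ w x - p x := by
    intro x
    rcases (hp x).eq_or_lt with h | h
    · rw [← h]; simpa using (hw x).le
    · have h1 := Real.log_le_sub_one_of_pos (div_pos (hw x) h)
      rw [Real.log_div (hw x).ne' h.ne'] at h1
      have h2 := mul_le_mul_of_nonneg_left h1 h.le
      have h3 : p x * (w x / p x - 1) = w x - p x := by field_simp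
      linarith
  have hs := Finset.sum_le_sum fun x (_ : x ∈ Finset.univ) => key x
  rw [Finset.sum_sub_distrib, Finset.sum_sub_distrib, hsum] at hs
  simp only [Real.logb, Finset.sum_neg_distrib, mul_neg, ← mul_div_assoc, ← Finset.sum_div]
  rw [neg_le_neg_iff, div_le_div_iff_of_pos_right hl]
  linarith

/-- Gibbs' inequality against weight `1/(2K)` on `G` and `1/(2M)` off it: the halving costs one bit,
and `log M` is paid only on the mass outside `G`. -/
lemma entropyBits_le_of_finset (Q : Measure Ω) [IsProbabilityMeasure Q] {X : Ω → α}
    (hX : ∀ x, MeasurableSet (X ⁻¹' {x})) (G : Finset α) {K M : ℝ} (hK : 1 ≤ K) (hM : 1 ≤ M)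
    (hG : (G.card : ℝ) ≤ K) (hα : (Fintype.card α : ℝ) ≤ M) :
    entropyBits Q X ≤ 1 + Real.logb 2 K + Q.real (X ⁻¹' (G : Set α)ᶜ) * Real.logb 2 M := by
  classical
  have hsum : ∑ x, Q.real (X ⁻¹' {x}) = 1 := by
    rw [sum_measureReal_preimage_singleton _ fun x _ => hX x]; simp
  have hsumG : ∑ x ∈ Gᶜ, Q.real (X ⁻¹' {x}) = Q.real (X ⁻¹' (G : Set α)ᶜ) := by
    rw [sum_measureReal_preimage_singleton _ fun x _ => hX x, Finset.coe_compl]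
  have hsumG' : ∑ x ∈ G, Q.real (X ⁻¹' {x}) ≤ 1 := by
    rw [← hsum]
    exact Finset.sum_le_sum_of_subset_of_nonneg (Finset.subset_univ _)
      fun _ _ _ => measureReal_nonneg
  set w : α → ℝ := fun x => if x ∈ G then (2 * K)⁻¹ else (2 * M)⁻¹ with hw
  have hw1 : ∑ x, w x ≤ 1 := by
    rw [← Finset.sum_add_sum_compl G]
    have h1 : ∑ x ∈ G, w x = G.card * (2 * K)⁻¹ := by
      rw [Finset.sum_congr rfl fun x hx => if_pos hx]; simp
    have h2 : ∑ x ∈ Gᶜ, w x = (Gᶜ).card * (2 * M)⁻¹ := by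
      rw [Finset.sum_congr rfl fun x hx => if_neg (Finset.mem_compl.1 hx)]; simp
    have h3 : ((Gᶜ).card : ℝ) ≤ M := le_trans (by exact_mod_cast Finset.card_le_univ _) hα
    rw [h1, h2]
    have h4 : (G.card : ℝ) * (2 * K)⁻¹ ≤ 1 / 2 := by
      rw [← div_eq_mul_inv, div_le_iff₀ (by linarith)]; linarith
    have h5 : ((Gᶜ).card : ℝ) * (2 * M)⁻¹ ≤ 1 / 2 := by
      rw [← div_eq_mul_inv, div_le_iff₀ (by linarith)]; linarith
    linarith
  have hlog : ∀ c : ℝ, 1 ≤ c → -Real.logb 2 (2 * c)⁻¹ = 1 + Real.logb 2 c := by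
    intro c hc
    rw [Real.logb_inv, neg_neg, Real.logb_mul two_ne_zero (by linarith),
      Real.logb_self_eq_one one_lt_two]
  have hlogK := Real.logb_nonneg one_lt_two hK
  have hlogM := Real.logb_nonneg one_lt_two hM
  have hwpos : ∀ x, 0 < w x := by
    intro x
    simp only [hw]
    split_ifs <;> positivity
  refine (sum_mul_neg_logb_le (fun _ => measureReal_nonneg) hsum hwpos hw1).trans ?_
  rw [← Finset.sum_add_sum_compl G] at hsum ⊢
  rw [Finset.sum_congr rfl (g := fun x => Q.real (X ⁻¹' {x}) * (1 + Real.logb 2 K))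
    fun x hx => by rw [hw]; simp only [if_pos hx]; rw [hlog K hK],
    Finset.sum_congr (s₁ := Gᶜ) rfl (g := fun x => Q.real (X ⁻¹' {x}) * (1 + Real.logb 2 M))
    fun x hx => by rw [hw]; simp only [if_neg (Finset.mem_compl.1 hx)]; rw [hlog M hM],
    ← Finset.sum_mul, ← Finset.sum_mul]
  rw [hsumG] at hsum ⊢
  nlinarith

lemma condEntropyBits_le_of_finset (P : Measure Ω) [IsProbabilityMeasure P] {X : Ω → α}
    {Y : Ω → β} (hX : ∀ x, MeasurableSet (X ⁻¹' {x})) (hY : ∀ y, MeasurableSet (Y ⁻¹' {y}))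
    (G : β → Finset α) {K M : ℝ} (hK : 1 ≤ K) (hM : 1 ≤ M)
    (hG : ∀ y, ((G y).card : ℝ) ≤ K) (hα : (Fintype.card α : ℝ) ≤ M) :
    condEntropyBits P X Y ≤
      1 + Real.logb 2 K + P.real {ω | X ω ∉ G (Y ω)} * Real.logb 2 M := by
  classical
  have hsum : ∑ y, P.real (Y ⁻¹' {y}) = 1 := by
    rw [sum_measureReal_preimage_singleton _ fun x _ => hY x]; simp
  have hXs : ∀ s : Set α, MeasurableSet (X ⁻¹' s) := by
    intro s
    rw [← Set.biUnion_preimage_singleton]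
    exact (Set.toFinite s).measurableSet_biUnion fun x _ => hX x
  have hbad : ∑ y, P.real (Y ⁻¹' {y} ∩ X ⁻¹' (G y : Set α)ᶜ) = P.real {ω | X ω ∉ G (Y ω)} := by
    rw [← measureReal_biUnion_finset]
    · congr 1
      ext ω
      simp
    · intro y _ y' _ hne
      refine Set.disjoint_left.2 fun ω h h' => hne ?_
      exact h.1.symm.trans h'.1
    · exact fun y _ => (hY y).inter (hXs _)
  calc condEntropyBits P X Y
      ≤ ∑ y, (P.real (Y ⁻¹' {y}) * (1 + Real.logb 2 K) +
          P.real (Y ⁻¹' {y} ∩ X ⁻¹' (G y : Set α)ᶜ) * Real.logb 2 M) := by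
        refine Finset.sum_le_sum fun y _ => ?_
        by_cases h0 : P (Y ⁻¹' {y}) = 0
        · have h1 : P.real (Y ⁻¹' {y}) = 0 := by simp [Measure.real, h0]
          rw [h1]
          simp only [zero_mul, zero_add]
          exact mul_nonneg measureReal_nonneg (Real.logb_nonneg one_lt_two hM)
        · have := cond_isProbabilityMeasure (μ := P) h0
          have h1 : 0 < P.real (Y ⁻¹' {y}) := ENNReal.toReal_pos h0 (measure_ne_top _ _)
          refine (mul_le_mul_of_nonneg_left
            (entropyBits_le_of_finset _ hX (G y) hK hM (hG y) hα) h1.le).trans_eq ?_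
          rw [cond_real_apply (hY y)]
          field_simp
    _ = _ := by
        rw [Finset.sum_add_distrib, ← Finset.sum_mul, ← Finset.sum_mul, hsum, hbad, one_mul]

end EntropyBound

/-! ### Chernoff bound for hit counts -/

section Chernoff

variable {Ω ι β : Type*} [MeasurableSpace Ω] [MeasurableSpace β] {μ : Measure Ω}
  [IsProbabilityMeasure μ]

/-- At parameter `log 2` the exponential of an indicator is one plus the indicator, so the mgf is `1
+ P ≤ e^P`. -/
lemma mgf_indicator_log_two_le {W : Ω → β} (hW : Measurable W) {A : Set β}
    (hA : MeasurableSet A) :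
    mgf (A.indicator 1 ∘ W) μ (Real.log 2) ≤ Real.exp (μ.real (W ⁻¹' A)) := by
  have h : ∀ ω, Real.exp (Real.log 2 * (A.indicator (1 : β → ℝ) ∘ W) ω)
      = (W ⁻¹' A).indicator (fun _ => (1 : ℝ)) ω + 1 := by
    intro ω
    by_cases hω : W ω ∈ A
    · rw [Set.indicator_of_mem (show ω ∈ W ⁻¹' A from hω), Function.comp,
        Set.indicator_of_mem hω, Pi.one_apply, mul_one, Real.exp_log two_pos]
      norm_num
    · rw [Set.indicator_of_notMem (show ω ∉ W ⁻¹' A from hω), Function.comp,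
        Set.indicator_of_notMem hω]
      simp
  rw [mgf, integral_congr_ae (Eventually.of_forall h), integral_add
    ((integrable_const _).indicator (hW hA)) (integrable_const _),
    integral_indicator_const _ (hW hA)]
  simpa using Real.add_one_le_exp (μ.real (W ⁻¹' A))

open Classical in
/-- Chernoff's bound for the number of hits of `A` among independent samples. -/
lemma measureReal_card_hits_ge_le [Fintype ι] {V : ι → Ω → β} (hind : iIndepFun V μ)
    (hV : ∀ l, Measurable (V l)) {A : Set β} (hA : MeasurableSet A) {q : ℝ}
    (hq : ∀ l, μ.real (V l ⁻¹' A) ≤ q) (K : ℝ) :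
    μ.real {ω | K ≤ (Finset.univ.filter fun l => V l ω ∈ A).card} ≤
      Real.exp (Fintype.card ι * q - Real.log 2 * K) := by
  have hgm : Measurable (A.indicator (1 : β → ℝ)) := measurable_one.indicator hA
  have hXm : ∀ l, Measurable (A.indicator (1 : β → ℝ) ∘ V l) := fun l => hgm.comp (hV l)
  have hindX := hind.comp (fun _ => A.indicator (1 : β → ℝ)) fun _ => hgm
  have hcount : ∀ ω, ((Finset.univ.filter fun l => V l ω ∈ A).card : ℝ)
      = (∑ l, A.indicator (1 : β → ℝ) ∘ V l) ω := by
    intro ω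
    rw [Finset.sum_apply, Finset.card_filter, Nat.cast_sum]
    refine Finset.sum_congr rfl fun l _ => ?_
    by_cases h : V l ω ∈ A <;> simp [h]
  have hint : Integrable
      (fun ω => Real.exp (Real.log 2 * (∑ l, A.indicator (1 : β → ℝ) ∘ V l) ω)) μ := by
    refine Integrable.of_bound (C := Real.exp (Real.log 2 * Fintype.card ι)) ?_ ?_
    · simp only [Finset.sum_apply]
      exact (Real.measurable_exp.comp
        ((Finset.measurable_sum _ fun l _ => hXm l).const_mul _)).aestronglyMeasurable
    · refine Eventually.of_forall fun ω => ?_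
      rw [Real.norm_eq_abs, Real.abs_exp, Real.exp_le_exp, ← hcount]
      refine mul_le_mul_of_nonneg_left ?_ (Real.log_nonneg one_le_two)
      exact_mod_cast Finset.card_le_univ _
  simp only [hcount]
  refine (measure_ge_le_exp_mul_mgf K (Real.log_nonneg one_le_two) hint).trans ?_
  rw [hindX.mgf_sum hXm, sub_eq_add_neg, add_comm, Real.exp_add, neg_mul]
  refine mul_le_mul_of_nonneg_left ?_ (Real.exp_pos _).le
  calc ∏ l, mgf (A.indicator 1 ∘ V l) μ (Real.log 2) ≤ ∏ _l : ι, Real.exp q :=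
        Finset.prod_le_prod (fun _ _ => mgf_nonneg) fun l _ =>
          (mgf_indicator_log_two_le (hV l) hA).trans (Real.exp_le_exp.2 (hq l))
    _ = _ := by rw [Finset.prod_const, ← Real.exp_nat_mul, Finset.card_univ]

end Chernoff

/-! ### The list of typical indices -/

section Packing

variable {A B C : Type*} [Fintype A] [Fintype B] [Fintype C]
  [MeasurableSpace A] [MeasurableSingletonClass A]
  [MeasurableSpace B] [MeasurableSingletonClass B]
  [MeasurableSpace C] [MeasurableSingletonClass C]
  {Ω ι : Type*} [MeasurableSpace Ω] [Fintype ι] {P : Measure Ω} [IsProbabilityMeasure P]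
  {p : PMF (A × B × C)} {n : ℕ} {U : Ω → Fin n → A} {V : ι → Ω → Fin n → B}

open Classical in
/-- The indices whose codeword is jointly typical with `(uⁿ, zⁿ)`. -/
def typicalIndices (p : PMF (A × B × C)) (ε : ℝ) (u : Fin n → A) (v : ι → Fin n → B)
    (z : Fin n → C) : Finset ι :=
  Finset.univ.filter fun l => (fun i => (u i, v l i, z i)) ∈ typicalSet p ε n

lemma IsRandomCodebook.cond_card_typicalIndices_ge_le (hUV : IsRandomCodebook p P U V)
    (hV : ∀ l, Measurable (V l)) (ε K : ℝ) (u : Fin n → A) (hu : P (U ⁻¹' {u}) ≠ 0)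
    (z : Fin n → C) :
    (P[|U ⁻¹' {u}]).real {ω | K ≤ (typicalIndices p ε u (fun l => V l ω) z).card} ≤
      Real.exp (Fintype.card ι * 2 ^ (-(n * (infoVZgivenU p - ε * meanAbsInfoDensity p)))
        - Real.log 2 * K) := by
  classical
  have := cond_isProbabilityMeasure (μ := P) hu
  obtain ⟨hind, hlaw⟩ := hUV.2 u hu
  set A' : Set (Fin n → B) := {v | (fun i => (u i, v i, z i)) ∈ typicalSet p ε n} with hA'
  have hA'm : MeasurableSet A' := (Set.toFinite _).measurableSet
  have hprob : ∀ l, (P[|U ⁻¹' {u}]).real (V l ⁻¹' A') ≤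
      2 ^ (-(n * (infoVZgivenU p - ε * meanAbsInfoDensity p))) := by
    intro l
    have hcoe : A' = ((Finset.univ.filter fun v : Fin n → B =>
        (fun i => (u i, v i, z i)) ∈ typicalSet p ε n : Finset _) : Set (Fin n → B)) := by
      ext v
      simp [hA']
    rw [hcoe, ← sum_measureReal_preimage_singleton _
      fun v _ => hV l (measurableSet_singleton v), Finset.sum_congr rfl fun v _ => hlaw l v]
    exact sum_prod_pmfVgivenU_typical_le p ε u z
  have hset : {ω | K ≤ (typicalIndices p ε u (fun l => V l ω) z).card} =
      {ω | K ≤ (Finset.univ.filter fun l => V l ω ∈ A').card} := by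
    ext ω
    have : typicalIndices p ε u (fun l => V l ω) z
        = Finset.univ.filter fun l => V l ω ∈ A' := by
      ext l
      simp [typicalIndices, hA']
    rw [Set.mem_ofPred_eq, Set.mem_ofPred_eq, this]
  rw [hset]
  exact measureReal_card_hits_ge_le hind hV hA'm hprob K

/-- Conditioning on `U` handles each fixed `z`; the factor `|C|^n` is the union bound that permits
arbitrary dependence of `Z` on the codebook. -/
lemma IsRandomCodebook.card_typicalIndices_ge_le (hUV : IsRandomCodebook p P U V)
    (hU : Measurable U) (hV : ∀ l, Measurable (V l)) (ε K : ℝ) (Z : Ω → Fin n → C) :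
    P.real {ω | K ≤ (typicalIndices p ε (U ω) (fun l => V l ω) (Z ω)).card} ≤
      (Fintype.card C : ℝ) ^ n *
      Real.exp (Fintype.card ι * 2 ^ (-(n * (infoVZgivenU p - ε * meanAbsInfoDensity p)))
        - Real.log 2 * K) := by
  classical
  set R := Real.exp (Fintype.card ι * 2 ^ (-(n * (infoVZgivenU p - ε * meanAbsInfoDensity p)))
    - Real.log 2 * K) with hR
  have hfix : ∀ z : Fin n → C,
      P.real {ω | K ≤ (typicalIndices p ε (U ω) (fun l => V l ω) z).card} ≤ R := by
    intro z
    have hcover : {ω | K ≤ (typicalIndices p ε (U ω) (fun l => V l ω) z).card} ⊆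
        ⋃ u ∈ (Finset.univ : Finset (Fin n → A)),
          (U ⁻¹' {u} ∩ {ω | K ≤ (typicalIndices p ε u (fun l => V l ω) z).card}) := by
      intro ω hω
      simpa using hω
    refine (measureReal_mono hcover (measure_ne_top _ _)).trans ((measureReal_biUnion_finset_le _ _).trans ?_)
    have hsum : ∑ u, P.real (U ⁻¹' {u}) = 1 := by
      rw [sum_measureReal_preimage_singleton _ fun u _ => hU (measurableSet_singleton u)]; simp
    rw [← one_mul R, ← hsum, Finset.sum_mul]
    refine Finset.sum_le_sum fun u _ => ?_
    by_cases hu : P (U ⁻¹' {u}) = 0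
    · have h0 : P.real (U ⁻¹' {u}) = 0 := by simp [Measure.real, hu]
      rw [h0, zero_mul, ← h0]
      exact measureReal_mono Set.inter_subset_left
    · have h1 : 0 < P.real (U ⁻¹' {u}) := ENNReal.toReal_pos hu (measure_ne_top _ _)
      have h2 := hUV.cond_card_typicalIndices_ge_le hV ε K u hu z
      rw [cond_real_apply (hU (measurableSet_singleton u)), inv_mul_le_iff₀ h1] at h2
      exact h2
  have hcover : {ω | K ≤ (typicalIndices p ε (U ω) (fun l => V l ω) (Z ω)).card} ⊆
      ⋃ z ∈ (Finset.univ : Finset (Fin n → C)),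
        {ω | K ≤ (typicalIndices p ε (U ω) (fun l => V l ω) z).card} := by
    intro ω hω
    rw [Set.mem_ofPred_eq] at hω
    simp only [Set.mem_iUnion, Set.mem_ofPred_eq, Finset.mem_univ, exists_true_left]
    exact ⟨Z ω, hω⟩
  refine (measureReal_mono hcover (measure_ne_top _ _)).trans ((measureReal_biUnion_finset_le _ _).trans ?_)
  refine (Finset.sum_le_sum fun z _ => hfix z).trans_eq ?_
  simp

/-- With `Y = (Zⁿ, Uⁿ, 𝒞)`, the entropy of an index is governed by the number of typical indices,
up to the probability that it is exceeded or that `L` is not one of them. -/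
lemma condEntropyBits_index_le [DecidableEq ι] (hU : Measurable U) (hV : ∀ l, Measurable (V l))
    {Z : Ω → Fin n → C} (hZ : Measurable Z) {L : Ω → ι} (hL : ∀ l, MeasurableSet (L ⁻¹' {l}))
    (p : PMF (A × B × C)) (ε : ℝ) {K M : ℝ} (hK : 1 ≤ K) (hM : 1 ≤ M)
    (hι : (Fintype.card ι : ℝ) ≤ M) :
    condEntropyBits P L (fun ω => (Z ω, U ω, codebook U V ω)) ≤
      1 + Real.logb 2 K +
      ((1 - P.real {ω | (fun i => (U ω i, V (L ω) ω i, Z ω i)) ∈ typicalSet p ε n}) +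
        P.real {ω | K ≤ (typicalIndices p ε (U ω) (fun l => V l ω) (Z ω)).card}) *
      Real.logb 2 M := by
  classical
  -- Emptying an overlong list keeps the size bound valid for every `y`; the overflow is charged to
  -- the error probability.
  set G : (Fin n → C) × (Fin n → A) × (Fin n → A) × (ι → Fin n → B) → Finset ι := fun y =>
    if ((typicalIndices p ε y.2.1 y.2.2.2 y.1).card : ℝ) ≤ K
      then typicalIndices p ε y.2.1 y.2.2.2 y.1 else ∅ with hGdef
  have hG : ∀ y, ((G y).card : ℝ) ≤ K := by
    intro y
    simp only [hGdef]
    split_ifs with h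
    · exact h
    · simpa using zero_le_one.trans hK
  have hYm : Measurable (fun ω => (Z ω, U ω, codebook U V ω)) :=
    hZ.prodMk (hU.prodMk (hU.prodMk (measurable_pi_lambda _ hV)))
  have hLs : ∀ s : Set ι, MeasurableSet (L ⁻¹' s) := by
    intro s
    rw [← Set.biUnion_preimage_singleton]
    exact (Set.toFinite s).measurableSet_biUnion fun x _ => hL x
  have hT : MeasurableSet {ω | (fun i => (U ω i, V (L ω) ω i, Z ω i)) ∈ typicalSet p ε n} := by
    have : {ω | (fun i => (U ω i, V (L ω) ω i, Z ω i)) ∈ typicalSet p ε n} =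
        ⋃ l : ι, (L ⁻¹' {l} ∩ (fun ω => (U ω, V l ω, Z ω)) ⁻¹'
          {t | (fun i => (t.1 i, t.2.1 i, t.2.2 i)) ∈ typicalSet p ε n}) := by
      ext ω; simp
    rw [this]
    exact MeasurableSet.iUnion fun l => (hL l).inter
      ((hU.prodMk ((hV l).prodMk hZ)) (Set.toFinite _).measurableSet)
  refine (condEntropyBits_le_of_finset P hL (fun y => hYm (measurableSet_singleton y)) G hK hM
    hG hι).trans ?_
  gcongr
  · exact Real.logb_nonneg one_lt_two hM
  rw [← probReal_compl_eq_one_sub hT]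
  refine (measureReal_mono ?_).trans (measureReal_union_le _ _)
  intro ω hω
  by_contra hcon
  simp only [Set.mem_union, Set.mem_compl_iff, Set.mem_ofPred_eq, not_or, not_not, not_le] at hcon
  refine hω ?_
  simp only [hGdef, codebook]
  rw [if_pos hcon.2.le]
  exact Finset.mem_filter.2 ⟨Finset.mem_univ _, hcon.1⟩

end Packing

/-! ### Doubly exponential decay beats exponential growth -/

section Asymptotics

lemma tendsto_pow_mul_exp_sub_two_rpow (c : ℕ) {a ε : ℝ} (ha : 0 < a) (hε : 0 < ε) :
    Tendsto (fun n : ℕ => (c : ℝ) ^ n * Real.exp (-(a * 2 ^ (n * ε)))) atTop (𝓝 0) := by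
  set b := a * ((ε * Real.log 2) ^ 2 / 2) with hb
  have hb0 : 0 < b := by
    have := Real.log_pos one_lt_two
    positivity
  have hlim : Tendsto (fun n : ℕ => (n : ℝ) * (c - b * n)) atTop atBot := by
    refine tendsto_natCast_atTop_atTop.atTop_mul_atBot₀ ?_
    simp only [sub_eq_add_neg]
    exact tendsto_const_nhds.add_atBot
      (tendsto_neg_atTop_atBot.comp (tendsto_natCast_atTop_atTop.const_mul_atTop hb0))
  refine squeeze_zero (fun n => by positivity) (fun n => ?_) (Real.tendsto_exp_atBot.comp hlim)
  have h1 : (c : ℝ) ^ n ≤ Real.exp (n * c) := by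
    rw [Real.exp_nat_mul]
    exact pow_le_pow_left₀ (Nat.cast_nonneg c) (by linarith [Real.add_one_le_exp (c : ℝ)]) n
  have hx : 0 ≤ Real.log 2 * (n * ε) := by
    have := Real.log_pos one_lt_two
    positivity
  -- A quadratic lower bound on `2^{nε}` already dominates the linear exponent `n * c`.
  have h2 := Real.quadratic_le_exp_of_nonneg hx
  rw [Function.comp, Real.rpow_def_of_pos two_pos]
  calc _ ≤ Real.exp (n * c) * Real.exp (-(a * Real.exp (Real.log 2 * (n * ε)))) := by gcongr
    _ = Real.exp (n * c - a * Real.exp (Real.log 2 * (n * ε))) := by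
      rw [← Real.exp_add, sub_eq_add_neg]
    _ ≤ _ := by
      rw [Real.exp_le_exp]
      have h3 : a * ((Real.log 2 * (n * ε)) ^ 2 / 2)
          ≤ a * Real.exp (Real.log 2 * (n * ε)) := by
        refine mul_le_mul_of_nonneg_left ?_ ha.le
        linarith
      have h4 : (n : ℝ) * (c - b * n) = n * c - a * ((Real.log 2 * (n * ε)) ^ 2 / 2) := by
        rw [hb]; ring
      linarith

/-- A hit count with mean at most `2 · 2^{-nε} K` has `exp (mean - log 2 · K)` vanishing faster
than any exponential, when `K ≥ 2^{nε}`. -/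
lemma tendsto_pow_mul_exp_sub (c : ℕ) {ε : ℝ} (hε : 0 < ε) {m K : ℕ → ℝ}
    (hK : ∀ n : ℕ, (2 : ℝ) ^ (n * ε) ≤ K n)
    (hm : ∀ n : ℕ, m n ≤ 2 * 2 ^ (-(n * ε)) * K n) :
    Tendsto (fun n : ℕ => (c : ℝ) ^ n * Real.exp (m n - Real.log 2 * K n)) atTop (𝓝 0) := by
  have hl : 0 < Real.log 2 := Real.log_pos one_lt_two
  have hsmall : ∀ᶠ n : ℕ in atTop, (2 : ℝ) * 2 ^ (-(n * ε)) ≤ Real.log 2 / 2 := by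
    have : Tendsto (fun n : ℕ => (2 : ℝ) * 2 ^ (-(n * ε))) atTop (𝓝 (2 * 0)) := by
      refine Tendsto.const_mul 2 ?_
      refine (tendsto_rpow_atBot_of_base_gt_one 2 one_lt_two).comp
        (tendsto_neg_atTop_atBot.comp (tendsto_natCast_atTop_atTop.atTop_mul_const hε))
    rw [mul_zero] at this
    exact this.eventually_le_const (by positivity)
  refine squeeze_zero' (Eventually.of_forall fun n => by positivity) ?_
    (tendsto_pow_mul_exp_sub_two_rpow c (half_pos hl) hε)
  filter_upwards [hsmall] with n hn
  refine mul_le_mul_of_nonneg_left (Real.exp_le_exp.2 ?_) (by positivity)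
  have hK0 : 0 ≤ K n := le_trans (by positivity) (hK n)
  have h1 := mul_le_mul_of_nonneg_right hn hK0
  have h2 := mul_le_mul_of_nonneg_left (hK n) (half_pos hl).le
  linarith [hm n]

end Asymptotics

end

/-! ### Choice of constants and conclusion -/

theorem lemma1 {𝒰 𝒱 𝒵 : Type*} [Fintype 𝒰] [Fintype 𝒱] [Fintype 𝒵]
    [MeasurableSpace 𝒰] [MeasurableSingletonClass 𝒰]
    [MeasurableSpace 𝒱] [MeasurableSingletonClass 𝒱]
    [MeasurableSpace 𝒵] [MeasurableSingletonClass 𝒵]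
    -- `(U, V, Z) ∼ p(u, v, z)`
    (p : PMF (𝒰 × 𝒱 × 𝒵))
    -- any nonnegative `δ(ε)` that tends to zero with `ε`
    (δ : ℝ → ℝ) (hδ_nonneg : ∀ ε, 0 < ε → 0 ≤ δ ε) (hδ : Tendsto δ (𝓝[>] 0) (𝓝 0)) :
    ∃ δ' : ℝ → ℝ, (∀ ε, 0 < ε → 0 < δ' ε) ∧ Tendsto δ' (𝓝[>] 0) (𝓝 0) ∧
      ∀ (S ε : ℝ), 0 ≤ S → 0 < ε → infoVZgivenU p + δ ε ≤ S →
      -- `M n` is the number of indices in `[1 : 2^{nS}]`, under any rounding convention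
      ∀ (M : ℕ → ℕ), (∀ n : ℕ, ⌊(2 : ℝ) ^ (n * S)⌋₊ ≤ M n ∧ M n ≤ 2 ^ ⌈n * S⌉₊) →
      ∀ (Ω : ℕ → Type*) [∀ n, MeasurableSpace (Ω n)]
        (P : ∀ n, Measure (Ω n)) [∀ n, IsProbabilityMeasure (P n)]
        (U : ∀ n, Ω n → Fin n → 𝒰) (V : ∀ n, Fin (M n) → Ω n → Fin n → 𝒱)
        (Z : ∀ n, Ω n → Fin n → 𝒵) (L : ∀ n, Ω n → Fin (M n)),
        (∀ n, Measurable (U n)) → (∀ n l, Measurable (V n l)) →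
        (∀ n, Measurable (Z n)) → (∀ n, Measurable (L n)) →
        (∀ n, IsRandomCodebook p (P n) (U n) (V n)) →
        Tendsto (fun n => (P n).real
            {ω | (fun i => (U n ω i, V n (L n ω) ω i, Z n ω i)) ∈ typicalSet p ε n})
          atTop (𝓝 1) →
        ∀ᶠ n : ℕ in atTop,
          condEntropyBits (P n) (L n)
              (fun ω => (Z n ω, U n ω, codebook (U n) (V n) ω)) ≤
            n * (S - infoVZgivenU p) + n * δ' ε := by
  set c := meanAbsInfoDensity p with hc
  have hc0 : 0 ≤ c := meanAbsInfoDensity_nonneg p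
  -- Of `(c + 3) * ε`, the part `(c + 1) * ε` comes from `log K`, one `ε` absorbs the additive bit,
  -- and one the error term.
  refine ⟨fun ε => (c + 3) * ε, fun ε hε => by positivity, ?_, ?_⟩
  · have : Tendsto (fun ε : ℝ => (c + 3) * ε) (𝓝 0) (𝓝 ((c + 3) * 0)) :=
      tendsto_id.const_mul _
    rw [mul_zero] at this
    exact this.mono_left nhdsWithin_le_nhds
  intro S ε hS hε hSI M hM Ω _ P _ U V Z L hU hV hZ hL hUV hT
  set I := infoVZgivenU p with hI
  have hrate : 0 ≤ S - I := by linarith [hδ_nonneg ε hε]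
  set K : ℕ → ℝ := fun n => 2 ^ (n * (S - I + c * ε + ε)) with hKdef
  have hexp : ∀ n : ℕ, (n : ℝ) * ε ≤ n * (S - I + c * ε + ε) := fun n => by
    have : 0 ≤ c * ε := by positivity
    exact mul_le_mul_of_nonneg_left (by linarith) (Nat.cast_nonneg n)
  have hK : ∀ n : ℕ, (2 : ℝ) ^ (n * ε) ≤ K n := fun n =>
    Real.rpow_le_rpow_of_exponent_le one_le_two (hexp n)
  have hK1 : ∀ n, 1 ≤ K n := fun n =>
    (Real.one_le_rpow one_le_two (by positivity)).trans (hK n)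
  have hMle : ∀ n : ℕ, (M n : ℝ) ≤ 2 ^ (n * S + 1) := by
    intro n
    calc (M n : ℝ) ≤ (2 : ℝ) ^ (⌈n * S⌉₊ : ℝ) := by
          rw [Real.rpow_natCast]; exact_mod_cast (hM n).2
      _ ≤ _ := Real.rpow_le_rpow_of_exponent_le one_le_two
          (Nat.ceil_lt_add_one (by positivity)).le
  -- The factor 2 is the rounding loss in `M n`; the extra `ε` in the exponent of `K` supplies
  -- `2^{-nε}`.
  have hmean : ∀ n : ℕ, (Fintype.card (Fin (M n)) : ℝ) * 2 ^ (-(n * (I - ε * c)))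
      ≤ 2 * 2 ^ (-(n * ε)) * K n := by
    intro n
    rw [Fintype.card_fin]
    refine (mul_le_mul_of_nonneg_right (hMle n) (by positivity)).trans_eq ?_
    nth_rewrite 3 [← Real.rpow_one 2]
    rw [hKdef, ← Real.rpow_add two_pos, ← Real.rpow_add two_pos, ← Real.rpow_add two_pos]
    congr 1
    ring
  have hcount := tendsto_pow_mul_exp_sub (Fintype.card 𝒵) hε hK hmean
  have hbad := (hT.const_sub 1).add hcount
  rw [sub_self, zero_add] at hbad
  -- For `n ≥ 1`, `log M ≤ n * S + 1 ≤ n * (S + 1)`, so this error level costs at most `n * ε` bits.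
  have hη : 0 < ε / (S + 1) := by positivity
  filter_upwards [hbad.eventually_le_const hη, eventually_ge_atTop 1,
    tendsto_natCast_atTop_atTop.eventually_ge_atTop (1 / ε)] with n hn hn1 hn2
  have hn1' : (1 : ℝ) ≤ n := by exact_mod_cast hn1
  rw [div_le_iff₀ hε] at hn2
  have hb := (hUV n).card_typicalIndices_ge_le (hU n) (hV n) ε (K n) (Z n)
  have h := condEntropyBits_index_le (P := P n) (hU n) (hV n) (hZ n)
    (fun l => hL n (measurableSet_singleton l)) p ε (hK1 n)
    (M := 2 ^ (n * S + 1)) (Real.one_le_rpow one_le_two (by positivity))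
    (by rw [Fintype.card_fin]; exact hMle n)
  refine h.trans ?_
  rw [hKdef, Real.logb_rpow two_pos (by norm_num), Real.logb_rpow two_pos (by norm_num)]
  have hlast : ((1 - (P n).real
        {ω | (fun i => (U n ω i, V n (L n ω) ω i, Z n ω i)) ∈ typicalSet p ε n}) +
      (P n).real {ω | K n ≤ (typicalIndices p ε (U n ω) (fun l => V n l ω) (Z n ω)).card}) *
      (n * S + 1) ≤ n * ε := by
    calc _ ≤ ε / (S + 1) * (n * S + 1) := by
          refine mul_le_mul_of_nonneg_right ?_ (by positivity)
          linarith
      _ ≤ ε / (S + 1) * (n * (S + 1)) := by gcongr; linarith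
      _ = n * ε := by field_simp
  linarith
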